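/- Let $E$ be a finite set and $M$ a matroid on $E$. A family $\mathcal A=(A_1,\dots,A_k)$ of subsets of $E$ is a presentation of $M$ if the independent sets of $M$ are exactly the partial transversals of $\mathcal A$, i.e. the sets $\{e_j: j\in J\}$ with $J\subseteq[k]$ and the $e_j\in A_j$ distinct. A representation of $\mathcal A$ is the $0/1$ matrix $X$, with rows indexed by $E$ and columns by $[k]$, such that $X_{ej}=1$ iff $e\in A_j$; it is viable if $k$ equals the rank $r$ of $M$. On presentations of $M$ by $r$ sets write $\mathcal A\le\mathcal B$ if for some permutation $\sigma$ of $[r]$ one has $A_{\sigma(i)}\subseteq B_i$ for all $i\in[r]$; a presentation by $r$ sets is maximal if it is a maximal element for this relation (that is, $\mathcal A\le\mathcal B$ implies $\mathcal B\le\mathcal A$), and a representation is maximal if it represents a maximal presentation. Algorithm 1. Input: a viable representation $X$. Let $G$ be the bipartite graph on $E\sqcup[r]$ with edge set $\{(e,j):X_{ej}\neq0\}$. For $j=1,\dots,r$ in turn: let $G_j$ be the subgraph of the current $G$ induced on $\{e\in E:(e,j)\notin E(G)\}\sqcup([r]\setminus\{j\})$; let $\mathcal M_j$ be the collection of the largest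 sets $S$ of left vertices of $G_j$ that can be completely matched in $G_j$ into the right vertices; and add to $G$ the edge $(e,j)$ for every $e\in\bigcap_{S\in\mathcal M_j}S$. Output: the biadjacency matrix of the final $G$. Theorem. Let $X$ be a viable representation of a presentation $\mathcal A=(A_1,\dots,A_r)$ of the matroid $M$ of rank $r$. Then the output of Algorithm 1 on $X$ is a maximal representation of $M$. More precisely, it represents the family $\mathcal B=(B_1,\dots,B_r)$, where $B_j$ is the union of $A_j$ and the set of all coloops of $M\setminus A_j$; the family $\mathcal B$ is a maximal presentation of $M$; every presentation $\mathcal C$ of $M$ by $r$ sets satisfies $\mathcal C\le\mathcal B$; and every maximal presentation of $M$ is obtained from $\mathcal B$ by permuting its sets. -/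

import Mathlib

namespace TransversalPresentation

/-- `I` is (the underlying set of) a partial transversal of the family `A`: there are a set `J` of
indices and distinct elements `e j ∈ A j`, for `j ∈ J`, with `I = {e j : j ∈ J}`. -/
def IsPartialTransversal {E : Type*} {k : ℕ} (A : Fin k → Set E) (I : Set E) : Prop :=
  ∃ (J : Set (Fin k)) (e : J → E),
    Function.Injective e ∧ (∀ j : J, e j ∈ A j) ∧ Set.range e = I

/-- `A` is a presentation of the matroid `M` on the set `E`, that is, `M = M[A]`: the independent
sets of `M` are the partial transversals of `A`. -/
def IsPresentation {E : Type*} {k : ℕ} (M : Matroid E) (A : Fin k → Set E) : Prop :=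
  M.E = Set.univ ∧ ∀ I : Set E, M.Indep I ↔ IsPartialTransversal A I

/-- The order on presentations with `k` sets: `A ≤ B` iff, for some permutation `σ`,
`A (σ i) ⊆ B i` for all `i`. -/
def PresentationLE {E : Type*} {k : ℕ} (A B : Fin k → Set E) : Prop :=
  ∃ σ : Equiv.Perm (Fin k), ∀ i, A (σ i) ⊆ B i

/-- `A` is a maximal presentation of `M`: a presentation by `rank M` sets that is a maximal element
among all such presentations. -/
def IsMaximalPresentation {E : Type*} {k : ℕ} (M : Matroid E) (A : Fin k → Set E) : Prop :=
  IsPresentation M A ∧ M.eRank = k ∧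
    ∀ B : Fin k → Set E, IsPresentation M B → PresentationLE A B → PresentationLE B A

/-- The edge set of the bipartite graph with left vertices `E` and right vertices `Fin k` in which
`e` and `j` are adjacent iff `e ∈ A j`. -/
def edgesOfFamily {E : Type*} {k : ℕ} (A : Fin k → Set E) : Set (E × Fin k) :=
  {p | p.1 ∈ A p.2}

open Classical in
/-- The biadjacency matrix of the bipartite graph on `E ⊔ Fin k` with edge set `G`. -/
noncomputable def biadjacency {E : Type*} {k : ℕ} (G : Set (E × Fin k)) : Matrix E (Fin k) ℕ :=
  Matrix.of fun e j => if (e, j) ∈ G then 1 else 0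

/-- `X` represents the family `A`: it is the biadjacency matrix of the bipartite graph of `A`. -/
def IsRepresentation {E : Type*} {k : ℕ} (A : Fin k → Set E) (X : Matrix E (Fin k) ℕ) : Prop :=
  X = biadjacency (edgesOfFamily A)

/-- `X` is a viable representation of the presentation `A` of `M`: the number of sets in `A` is the
rank of `M`. -/
def IsViableRepresentation {E : Type*} {k : ℕ} (M : Matroid E) (A : Fin k → Set E)
    (X : Matrix E (Fin k) ℕ) : Prop :=
  IsPresentation M A ∧ IsRepresentation A X ∧ M.eRank = k

/-- `X` is a maximal representation of `M`: it represents a maximal presentation of `M`. -/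
def IsMaximalRepresentation {E : Type*} {k : ℕ} (M : Matroid E)
    (X : Matrix E (Fin k) ℕ) : Prop :=
  ∃ A : Fin k → Set E, IsMaximalPresentation M A ∧ IsRepresentation A X

/-- The edge set of the bipartite graph described by the matrix `X`. -/
def edgesOfMatrix {E : Type*} {k : ℕ} (X : Matrix E (Fin k) ℕ) : Set (E × Fin k) :=
  {p | X p.1 p.2 ≠ 0}

/-- The left vertices of `G_j`: those not adjacent to the right vertex `j` in `G`. -/
def leftVertices {E : Type*} {k : ℕ} (G : Set (E × Fin k)) (j : Fin k) : Set E :=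
  {a | (a, j) ∉ G}

/-- The right vertices of `G_j`: all those other than `j`. -/
def rightVertices {k : ℕ} (j : Fin k) : Set (Fin k) :=
  {b | b ≠ j}

/-- The edges of `G_j`, the subgraph of `G` induced on `leftVertices G j ⊔ rightVertices j`. -/
def inducedEdges {E : Type*} {k : ℕ} (G : Set (E × Fin k)) (j : Fin k) : Set (E × Fin k) :=
  {p | p ∈ G ∧ p.1 ∈ leftVertices G j ∧ p.2 ∈ rightVertices j}

/-- `S` is a set of left vertices of `G_j` that can be completely matched in `G_j` into the right
vertices of `G_j`. -/
def IsMatchable {E : Type*} {k : ℕ} (G : Set (E × Fin k)) (j : Fin k) (S : Finset E) : Prop :=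
  (S : Set E) ⊆ leftVertices G j ∧
    ∃ f : S → rightVertices j,
      Function.Injective f ∧ ∀ s : S, ((s : E), (f s : Fin k)) ∈ inducedEdges G j

/-- The collection `M_j` of the matchable sets of left vertices of `G_j` of the largest size. -/
def maximumMatchable {E : Type*} {k : ℕ} (G : Set (E × Fin k)) (j : Fin k) : Set (Finset E) :=
  {S | IsMatchable G j S ∧ ∀ S' : Finset E, IsMatchable G j S' → S'.card ≤ S.card}

/-- The body of the loop: join `j` to every left vertex that lies in all members of `M_j`. -/
def step {E : Type*} {k : ℕ} (G : Set (E × Fin k)) (j : Fin k) : Set (E × Fin k) :=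
  G ∪ {p | p.2 = j ∧ ∀ S ∈ maximumMatchable G j, p.1 ∈ S}

/-- The algorithm: start from the graph of `X`, run the body of the loop once for each column, in
increasing order, and return the biadjacency matrix of the resulting graph. -/
noncomputable def algorithm {E : Type*} {k : ℕ} (X : Matrix E (Fin k) ℕ) : Matrix E (Fin k) ℕ :=
  biadjacency ((List.finRange k).foldl step (edgesOfMatrix X))

end TransversalPresentation

/-!
By Hall's theorem a circuit `C` of `M` meets fewer than `|C|` members of a presentation, and a
proper subset of `C` meets at least as many members as it has elements; so each matching of
`C \ {e}` uses every member that meets `C`. Hence a union `F` of circuits meets exactly `r(F)`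
members of any presentation.

An element lies in `A j` or is a coloop of `M ＼ A j` exactly when each circuit through it meets
`A j`. Enlarging `A j` by such elements does not change which circuits it meets, so the result is
still a presentation, and the complement of the enlarged set is a union of circuits. The number of
members of the enlarged family disjoint from a given union of circuits depends only on `M`, and
these numbers determine the complements of the members, with multiplicities. Therefore all
presentations by equally many sets have the same enlargement up to a permutation, which dominates
each of them.

In the algorithm the graph is always that of a presentation `A` of `M`. The matchable sets of `G_j`
are the independent sets of `M ＼ A j`, so that the intersection of the largest ones is the set of
coloops of `M ＼ A j`.
-/

namespace TransversalPresentation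

open Set
open scoped Matroid

section FamiliesInPartialOrders

variable {α ι : Type*}

lemma eq_of_forall_countP_le_eq [PartialOrder α] [DecidableLE α] {s t : Multiset α}
    (h : ∀ x ∈ s + t, s.countP (x ≤ ·) = t.countP (x ≤ ·)) : s = t := by
  classical
  induction hn : (s + t).card using Nat.strong_induction_on generalizing s t with
  | h n ih =>
    obtain hst | ⟨y, hy⟩ := (s + t).empty_or_exists_mem
    · obtain ⟨rfl, rfl⟩ := add_eq_zero.1 hst
      rfl
    obtain ⟨x, hx⟩ := (s + t).toFinset.exists_maximal ⟨y, Multiset.mem_toFinset.2 hy⟩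
    have hxst : x ∈ s + t := Multiset.mem_toFinset.1 hx.prop
    have eq_of_le {z : α} (hz : z ∈ s + t) (hxz : x ≤ z) : z = x :=
      (hx.eq_of_le (Multiset.mem_toFinset.2 hz) hxz).symm
    have countP_pos_iff {u : Multiset α} (hu : u ≤ s + t) : 0 < u.countP (x ≤ ·) ↔ x ∈ u := by
      refine Multiset.countP_pos.trans ⟨fun ⟨z, hz, hxz⟩ ↦ ?_, fun hxu ↦ ⟨x, hxu, le_rfl⟩⟩
      exact eq_of_le (Multiset.mem_of_le hu hz) hxz ▸ hz
    have mem_iff : x ∈ s ↔ x ∈ t := by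
      rw [← countP_pos_iff (Multiset.le_add_right s t), h x hxst,
        countP_pos_iff (Multiset.le_add_left t s)]
    have hxs : x ∈ s := (Multiset.mem_add.1 hxst).elim id mem_iff.2
    obtain ⟨s, rfl⟩ := Multiset.exists_cons_of_mem hxs
    obtain ⟨t, rfl⟩ := Multiset.exists_cons_of_mem (mem_iff.1 hxs)
    refine congrArg (x ::ₘ ·) (ih _ ?_ (fun z hz ↦ ?_) rfl)
    · simp only [← hn, Multiset.card_add, Multiset.card_cons]
      lia
    · have hz' := h z (Multiset.mem_of_le (add_le_add (s.le_cons_self x) (t.le_cons_self x)) hz)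
      simpa only [Multiset.countP_cons, Nat.add_right_cancel_iff] using hz'

lemma exists_perm_of_map_univ_eq [Fintype ι] {f g : ι → α}
    (h : Finset.univ.val.map f = Finset.univ.val.map g) :
    ∃ σ : Equiv.Perm ι, ∀ i, f i = g (σ i) := by
  classical
  have card_fiber_eq (x : α) : Fintype.card {i // f i = x} = Fintype.card {i // g i = x} := by
    have hx := congrArg (Multiset.countP (· = x)) h
    rw [Multiset.countP_map, Multiset.countP_map] at hx
    rw [Fintype.card_subtype, Fintype.card_subtype]
    exact hx
  have e (x : α) : {i // f i = x} ≃ {i // g i = x} := Fintype.equivOfCardEq (card_fiber_eq x)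
  exact ⟨Equiv.ofFiberEquiv e, fun i ↦ (Equiv.ofFiberEquiv_map e i).symm⟩

lemma exists_perm_of_forall_ncard_le_eq [PartialOrder α] [Finite ι] {f g : ι → α}
    (h : ∀ x ∈ range f ∪ range g, {i | x ≤ f i}.ncard = {i | x ≤ g i}.ncard) :
    ∃ σ : Equiv.Perm ι, ∀ i, f i = g (σ i) := by
  classical
  have := Fintype.ofFinite ι
  have countP_map_univ (u : ι → α) (x : α) :
      (Finset.univ.val.map u).countP (x ≤ ·) = {i | x ≤ u i}.ncard := by
    rw [Multiset.countP_map, ncard_eq_toFinset_card', toFinset_ofPred]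
    rfl
  refine exists_perm_of_map_univ_eq (eq_of_forall_countP_le_eq fun x hx ↦ ?_)
  rw [countP_map_univ, countP_map_univ]
  exact h x (by simpa using hx)

lemma ncard_setOf_le_le_of_perm [Preorder α] [Finite ι] {f g : ι → α} (σ : Equiv.Perm ι)
    (h : ∀ i, f (σ i) ≤ g i) (x : α) : {i | x ≤ f i}.ncard ≤ {i | x ≤ g i}.ncard := by
  rw [← ncard_preimage_of_injective_subset_range σ.injective (by simp)]
  exact ncard_le_ncard fun i (hi : x ≤ f (σ i)) ↦ hi.trans (h i)

end FamiliesInPartialOrders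

section Matchings

variable {E ι : Type*} {A B : ι → Set E} {S T : Set E}

/-- The indices of the members of the family `A` that meet `S`, that is, the neighbourhood of `S`
in the bipartite graph of `A`. -/
def neighbors (A : ι → Set E) (S : Set E) : Set ι :=
  {j | (S ∩ A j).Nonempty}

lemma neighbors_mono (A : ι → Set E) (h : S ⊆ T) : neighbors A S ⊆ neighbors A T :=
  fun _ hj ↦ hj.mono (inter_subset_inter_left _ h)

lemma setOf_subset_compl_eq (A : ι → Set E) (S : Set E) :
    {j | S ⊆ (A j)ᶜ} = (neighbors A S)ᶜ := by
  ext j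
  rw [mem_compl_iff, neighbors, mem_ofPred_eq, mem_ofPred_eq, not_nonempty_iff_eq_empty,
    ← disjoint_iff_inter_eq_empty, subset_compl_iff_disjoint_right]

/-- `f` is a matching of `S` into the indices in the bipartite graph of the family `A`. -/
structure IsMatching (A : ι → Set E) (f : S → ι) : Prop where
  injective : Function.Injective f
  mem : ∀ s : S, (s : E) ∈ A (f s)

namespace IsMatching

variable {f : S → ι}

lemma encard_image (hf : IsMatching A f) (hT : T ⊆ S) :
    (f '' (Subtype.val ⁻¹' T)).encard = T.encard := by
  rw [hf.injective.encard_image, encard_preimage_of_injective_subset_range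
    Subtype.val_injective (by simpa using hT)]

lemma image_subset_neighbors (hf : IsMatching A f) (T : Set E) :
    f '' (Subtype.val ⁻¹' T) ⊆ neighbors A T := by
  rintro _ ⟨s, hs, rfl⟩
  exact ⟨s, hs, hf.mem s⟩

end IsMatching

lemma exists_isMatching_iff_forall_encard_le [Finite ι] :
    (∃ f : S → ι, IsMatching A f) ↔ ∀ T ⊆ S, T.encard ≤ (neighbors A T).encard := by
  classical
  have := Fintype.ofFinite ι
  refine ⟨fun ⟨f, hf⟩ T hT ↦ ?_, fun h ↦ ?_⟩
  · rw [← hf.encard_image hT]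
    exact encard_le_encard (hf.image_subset_neighbors T)
  obtain ⟨f, hf, hfA⟩ := (Fintype.all_card_le_filter_rel_iff_exists_injective
    fun (s : S) j ↦ (s : E) ∈ A j).1 fun T ↦ by
      have hT := h (Subtype.val '' (T : Set S)) (Subtype.coe_image_subset S T)
      have neighbors_eq : neighbors A (Subtype.val '' (T : Set S)) =
          (Finset.univ.filter fun j ↦ ∃ s ∈ T, (s : E) ∈ A j : Finset ι) := by
        ext j
        simp [neighbors, Set.Nonempty]
      rw [Subtype.val_injective.encard_image, neighbors_eq] at hT
      simpa only [encard_coe_eq_coe_finsetCard, Nat.cast_le] using hT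
  exact ⟨f, hf, hfA⟩

end Matchings

section CyclicSets

variable {E : Type*} {M : Matroid E} {F I S C : Set E} {e : E}

/-- `F` is a cyclic set of `M`, that is, a union of circuits. -/
def IsCyclicSet (M : Matroid E) (F : Set E) : Prop :=
  ∀ x ∈ F, ∃ C ⊆ F, M.IsCircuit C ∧ x ∈ C

lemma IsCyclicSet.subset_ground (hF : IsCyclicSet M F) : F ⊆ M.E := fun x hx ↦
  let ⟨_, _, hC, hxC⟩ := hF x hx
  hC.subset_ground hxC

lemma IsCyclicSet.exists_mem_fundCircuit (hF : IsCyclicSet M F) (hI : M.IsBasis I F) (he : e ∈ F) :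
    ∃ x ∈ F \ I, e ∈ M.fundCircuit x I := by
  by_cases heI : e ∈ I
  · obtain ⟨C, hCF, hC, heC⟩ := hF e he
    have not_isColoop : ¬ (M ↾ F).IsColoop e :=
      (hC.isCircuit_restrict_of_subset hCF).not_isColoop_of_mem heC
    rw [hI.isBase_restrict.isColoop_iff_forall_notMem_fundCircuit heI] at not_isColoop
    push Not at not_isColoop
    obtain ⟨x, hx, hex⟩ := not_isColoop
    exact ⟨x, hx, by rwa [Matroid.fundCircuit_restrict hI.subset hx.1 hF.subset_ground] at hex⟩
  · exact ⟨e, ⟨he, heI⟩, M.mem_fundCircuit e I⟩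

/-- The union of `S` and the set of coloops of `M ＼ S`: the largest set to which a member `S` of
a presentation of `M` can be enlarged. -/
def coloopExtension (M : Matroid E) (S : Set E) : Set E :=
  S ∪ (M ＼ S).coloops

lemma subset_coloopExtension (M : Matroid E) (S : Set E) : S ⊆ coloopExtension M S :=
  subset_union_left

lemma mem_coloopExtension_iff (he : e ∈ M.E) :
    e ∈ coloopExtension M S ↔ ∀ C, M.IsCircuit C → e ∈ C → (C ∩ S).Nonempty := by
  by_cases heS : e ∈ S
  · exact iff_of_true (subset_coloopExtension M S heS) fun C _ heC ↦ ⟨e, heC, heS⟩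
  rw [coloopExtension, mem_union, or_iff_right heS, ← Matroid.isColoop_iff_mem_coloops,
    Matroid.isColoop_iff_forall_notMem_isCircuit (show e ∈ (M ＼ S).E from ⟨he, heS⟩)]
  simp only [Matroid.delete_isCircuit_iff, ← not_disjoint_iff_nonempty_inter]
  grind

lemma inter_nonempty_of_mem_coloopExtension (hC : M.IsCircuit C) (heC : e ∈ C)
    (he : e ∈ coloopExtension M S) : (C ∩ S).Nonempty :=
  (mem_coloopExtension_iff (hC.subset_ground heC)).1 he C hC heC

lemma isCyclicSet_sdiff_coloopExtension (M : Matroid E) (S : Set E) :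
    IsCyclicSet M (M.E \ coloopExtension M S) := by
  rintro x ⟨hx, hxS⟩
  rw [mem_coloopExtension_iff hx] at hxS
  push Not at hxS
  obtain ⟨C, hC, hxC, hCS⟩ := hxS
  refine ⟨C, fun y hy ↦ ⟨hC.subset_ground hy, fun hyS ↦ ?_⟩, hC, hxC⟩
  exact (inter_nonempty_of_mem_coloopExtension hC hy hyS).ne_empty hCS

end CyclicSets

section Presentations

variable {E : Type*} {k : ℕ} {M : Matroid E} {A B : Fin k → Set E} {I F C : Set E}

lemma isPartialTransversal_iff_exists_isMatching :
    IsPartialTransversal A I ↔ ∃ f : I → Fin k, IsMatching A f := by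
  constructor
  · rintro ⟨J, e, he, heA, rfl⟩
    refine ⟨fun s ↦ (Equiv.ofInjective e he).symm s,
      Subtype.val_injective.comp (Equiv.injective _), ?_⟩
    rintro ⟨_, j, rfl⟩
    simpa only [Equiv.ofInjective_symm_apply] using heA j
  · rintro ⟨f, hf, hfA⟩
    refine ⟨range f, fun j ↦ (Equiv.ofInjective f hf).symm j,
      Subtype.val_injective.comp (Equiv.injective _), ?_, ?_⟩
    · rintro ⟨_, s, rfl⟩
      simpa only [Equiv.ofInjective_symm_apply] using hfA s
    · rw [← Function.comp_def, (Equiv.surjective _).range_comp, Subtype.range_coe]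

lemma IsPartialTransversal.mono (hAB : ∀ j, A j ⊆ B j) (hI : IsPartialTransversal A I) :
    IsPartialTransversal B I :=
  let ⟨J, e, he, heA, heI⟩ := hI
  ⟨J, e, he, fun j ↦ hAB j (heA j), heI⟩

lemma isPartialTransversal_iff_forall_encard_le :
    IsPartialTransversal A I ↔ ∀ T ⊆ I, T.encard ≤ (neighbors A T).encard :=
  isPartialTransversal_iff_exists_isMatching.trans exists_isMatching_iff_forall_encard_le

namespace IsPresentation

lemma indep_iff_exists_isMatching (hA : IsPresentation M A) :
    M.Indep I ↔ ∃ f : I → Fin k, IsMatching A f :=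
  (hA.2 I).trans isPartialTransversal_iff_exists_isMatching

lemma indep_iff_forall_encard_le (hA : IsPresentation M A) :
    M.Indep I ↔ ∀ T ⊆ I, T.encard ≤ (neighbors A T).encard :=
  (hA.2 I).trans isPartialTransversal_iff_forall_encard_le

lemma rankFinite (hA : IsPresentation M A) : M.RankFinite := by
  obtain ⟨B, hB⟩ := M.exists_isBase
  obtain ⟨f, hf⟩ := hA.indep_iff_exists_isMatching.1 hB.indep
  exact hB.rankFinite_of_finite (Finite.of_injective f hf.injective)

lemma encard_neighbors_lt_of_isCircuit (hA : IsPresentation M A) (hC : M.IsCircuit C) :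
    (neighbors A C).encard < C.encard := by
  by_contra! hle
  refine hC.not_indep (hA.indep_iff_forall_encard_le.2 fun T hT ↦ ?_)
  obtain rfl | hTC := hT.eq_or_ssubset
  · exact hle
  · exact hA.indep_iff_forall_encard_le.1 (hC.ssubset_indep hTC) T subset_rfl

lemma neighbors_subset_range_of_isCircuit (hA : IsPresentation M A) (hC : M.IsCircuit C) {e : E}
    (heC : e ∈ C) (hCI : C \ {e} ⊆ I) {f : I → Fin k} (hf : IsMatching A f) :
    neighbors A C ⊆ range f := by
  have himage : f '' (Subtype.val ⁻¹' (C \ {e})) ⊆ neighbors A C :=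
    (hf.image_subset_neighbors _).trans (neighbors_mono A sdiff_subset)
  have hcard : (neighbors A C).encard ≤ (f '' (Subtype.val ⁻¹' (C \ {e}))).encard := by
    rw [hf.encard_image hCI]
    apply Order.le_of_lt_add_one
    rw [encard_sdiff_singleton_add_one heC]
    exact hA.encard_neighbors_lt_of_isCircuit hC
  rw [← (toFinite _).eq_of_subset_of_encard_le' himage hcard]
  exact image_subset_range _ _

lemma encard_neighbors_of_isCyclicSet (hA : IsPresentation M A) (hF : IsCyclicSet M F) :
    (neighbors A F).encard = M.eRk F := by
  obtain ⟨I, hI⟩ := M.exists_isBasis F hF.subset_ground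
  obtain ⟨f, hf⟩ := hA.indep_iff_exists_isMatching.1 hI.indep
  have neighbors_eq_range : neighbors A F = range f := by
    apply Subset.antisymm
    · rintro j ⟨e, he, hej⟩
      obtain ⟨x, hx, hex⟩ := hF.exists_mem_fundCircuit hI he
      exact hA.neighbors_subset_range_of_isCircuit
        (hI.indep.fundCircuit_isCircuit (hI.subset_closure hx.1) hx.2) (M.mem_fundCircuit x I)
        (by simpa using M.fundCircuit_subset_insert x I) hf ⟨e, hex, hej⟩
    · rintro _ ⟨s, rfl⟩
      exact ⟨s, hI.subset s.2, hf.mem s⟩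
  rw [neighbors_eq_range, ← image_univ, hf.injective.encard_image, encard_univ,
    ENat.card_coe_set_eq, hI.encard_eq_eRk]

lemma ncard_subset_compl_eq (hA : IsPresentation M A) (hB : IsPresentation M B)
    (hF : IsCyclicSet M F) : {j | F ⊆ (A j)ᶜ}.ncard = {j | F ⊆ (B j)ᶜ}.ncard := by
  rw [setOf_subset_compl_eq, setOf_subset_compl_eq, ncard_compl, ncard_compl, ncard_def, ncard_def,
    hA.encard_neighbors_of_isCyclicSet hF, hB.encard_neighbors_of_isCyclicSet hF]

lemma of_subset_coloopExtension (hA : IsPresentation M A) (hAB : ∀ j, A j ⊆ B j)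
    (hB : ∀ j, B j ⊆ coloopExtension M (A j)) : IsPresentation M B := by
  refine ⟨hA.1, fun I ↦ ⟨fun hI ↦ ((hA.2 I).1 hI).mono hAB, fun hI ↦ ?_⟩⟩
  rw [Matroid.indep_iff_forall_subset_not_isCircuit (hA.1 ▸ subset_univ I)]
  intro C hCI hC
  have neighbors_subset : neighbors B C ⊆ neighbors A C := fun j ⟨_, heC, hej⟩ ↦
    inter_nonempty_of_mem_coloopExtension hC heC (hB j hej)
  refine (hA.encard_neighbors_lt_of_isCircuit hC).not_ge ?_
  exact (isPartialTransversal_iff_forall_encard_le.1 hI C hCI).trans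
    (encard_le_encard neighbors_subset)

lemma isPresentation_coloopExtension (hA : IsPresentation M A) :
    IsPresentation M fun j ↦ coloopExtension M (A j) :=
  hA.of_subset_coloopExtension (fun _ ↦ subset_coloopExtension M _) fun _ ↦ subset_rfl

lemma exists_perm_coloopExtension_eq (hA : IsPresentation M A) (hB : IsPresentation M B) :
    ∃ σ : Equiv.Perm (Fin k), ∀ i,
      coloopExtension M (A i) = coloopExtension M (B (σ i)) := by
  have isCyclicSet_compl (S : Set E) : IsCyclicSet M (coloopExtension M S)ᶜ := by
    rw [compl_eq_univ_sdiff, ← hA.1]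
    exact isCyclicSet_sdiff_coloopExtension M S
  obtain ⟨σ, hσ⟩ := exists_perm_of_forall_ncard_le_eq
    (f := fun i ↦ (coloopExtension M (A i))ᶜ)
    (g := fun i ↦ (coloopExtension M (B i))ᶜ) (by
      rintro _ (⟨i, rfl⟩ | ⟨i, rfl⟩) <;>
      exact hA.isPresentation_coloopExtension.ncard_subset_compl_eq
        hB.isPresentation_coloopExtension (isCyclicSet_compl _))
  exact ⟨σ, fun i ↦ compl_injective (hσ i)⟩

lemma presentationLE_coloopExtension (hA : IsPresentation M A) (hB : IsPresentation M B) :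
    PresentationLE B fun j ↦ coloopExtension M (A j) := by
  obtain ⟨σ, hσ⟩ := hA.exists_perm_coloopExtension_eq hB
  exact ⟨σ, fun i ↦ (subset_coloopExtension M (B (σ i))).trans (hσ i).ge⟩

end IsPresentation

lemma PresentationLE.exists_perm_eq (hAB : PresentationLE A B) (hBA : PresentationLE B A) :
    ∃ σ : Equiv.Perm (Fin k), ∀ i, A i = B (σ i) := by
  obtain ⟨σ, hσ⟩ := hAB
  obtain ⟨τ, hτ⟩ := hBA
  exact exists_perm_of_forall_ncard_le_eq fun S _ ↦
    (ncard_setOf_le_le_of_perm σ hσ S).antisymm (ncard_setOf_le_le_of_perm τ hτ S)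

end Presentations

section Algorithm

variable {E : Type*} {k : ℕ} {M : Matroid E} {A : Fin k → Set E} {j : Fin k} {e : E}

lemma isBase_coe_iff_indep_and_forall_card_le [M.RankFinite] {S : Finset E} :
    M.IsBase S ↔ M.Indep S ∧ ∀ T : Finset E, M.Indep T → T.card ≤ S.card := by
  refine ⟨fun hS ↦ ⟨hS.indep, fun T hT ↦ ?_⟩, fun ⟨hS, hmax⟩ ↦ ?_⟩
  · have hle := hT.encard_le_eRank
    rw [← hS.encard_eq_eRank] at hle
    simpa only [encard_coe_eq_coe_finsetCard, Nat.cast_le] using hle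
  · obtain ⟨B, hB, hSB⟩ := hS.exists_isBase_superset
    lift B to Finset E using hB.finite
    rwa [Finset.eq_of_subset_of_card_le (Finset.coe_subset.1 hSB) (hmax B hB.indep)]

lemma edgesOfMatrix_biadjacency (G : Set (E × Fin k)) : edgesOfMatrix (biadjacency G) = G := by
  ext ⟨e, j⟩
  simp [edgesOfMatrix, biadjacency]

namespace IsPresentation

lemma isMatchable_iff (hA : IsPresentation M A) {S : Finset E} :
    IsMatchable (edgesOfFamily A) j S ↔ (M ＼ A j).Indep S := by
  rw [Matroid.delete_indep_iff, hA.indep_iff_exists_isMatching]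
  constructor
  · rintro ⟨hS, f, hf, hfS⟩
    exact ⟨⟨fun s ↦ f s, Subtype.val_injective.comp hf, fun s ↦ (hfS s).1⟩,
      disjoint_left.2 fun _ hx ↦ hS hx⟩
  · rintro ⟨⟨f, hf, hfA⟩, hS⟩
    have hleft : (S : Set E) ⊆ leftVertices (edgesOfFamily A) j := fun _ hx ↦ disjoint_left.1 hS hx
    have hright (s : S) : f s ∈ rightVertices j := fun h ↦ hleft s.2 (h ▸ hfA s)
    exact ⟨hleft, fun s ↦ ⟨f s, hright s⟩, fun _ _ hst ↦ hf (congrArg Subtype.val hst),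
      fun s ↦ ⟨hfA s, hleft s.2, hright s⟩⟩

lemma mem_maximumMatchable_iff (hA : IsPresentation M A) {S : Finset E} :
    S ∈ maximumMatchable (edgesOfFamily A) j ↔ (M ＼ A j).IsBase S := by
  have := hA.rankFinite
  simp only [maximumMatchable, mem_ofPred_eq, hA.isMatchable_iff,
    isBase_coe_iff_indep_and_forall_card_le]

lemma forall_mem_maximumMatchable_iff (hA : IsPresentation M A) :
    (∀ S ∈ maximumMatchable (edgesOfFamily A) j, e ∈ S) ↔ e ∈ (M ＼ A j).coloops := by
  have := hA.rankFinite
  simp only [hA.mem_maximumMatchable_iff, ← Matroid.isColoop_iff_mem_coloops,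
    Matroid.isColoop_iff_forall_mem_isBase]
  refine ⟨fun h B hB ↦ ?_, fun h S hS ↦ h hS⟩
  lift B to Finset E using hB.finite
  exact h B hB

lemma step_edgesOfFamily (hA : IsPresentation M A) (j : Fin k) :
    step (edgesOfFamily A) j =
      edgesOfFamily (Function.update A j (coloopExtension M (A j))) := by
  ext ⟨e, i⟩
  simp only [step, hA.forall_mem_maximumMatchable_iff]
  obtain rfl | hi := eq_or_ne i j
  · simp [edgesOfFamily, coloopExtension]
  · simp [edgesOfFamily, hi]

lemma foldl_step (hA : IsPresentation M A) {l : List (Fin k)} (hl : l.Nodup) :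
    l.foldl step (edgesOfFamily A) =
      edgesOfFamily fun i ↦ if i ∈ l then coloopExtension M (A i) else A i := by
  induction l using List.reverseRecOn with
  | nil => simp
  | append_singleton l j ih =>
    obtain ⟨hl, hjl⟩ : l.Nodup ∧ j ∉ l := by simpa [List.nodup_append, imp_not_comm] using hl
    have hB : IsPresentation M fun i ↦ if i ∈ l then coloopExtension M (A i) else A i := by
      refine hA.of_subset_coloopExtension (fun i ↦ ?_) fun i ↦ ?_ <;> split_ifs
      exacts [subset_coloopExtension M _, subset_rfl, subset_rfl, subset_coloopExtension M _]
    rw [List.foldl_append, ih hl, List.foldl_cons, List.foldl_nil, hB.step_edgesOfFamily,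
      if_neg hjl]
    congr 1
    funext i
    obtain rfl | hij := eq_or_ne i j
    · simp
    · simp [hij]

lemma isRepresentation_algorithm (hA : IsPresentation M A) {X : Matrix E (Fin k) ℕ}
    (hX : IsRepresentation A X) :
    IsRepresentation (fun j ↦ coloopExtension M (A j)) (algorithm X) := by
  rw [IsRepresentation] at hX ⊢
  rw [algorithm, hX, edgesOfMatrix_biadjacency, hA.foldl_step (List.nodup_finRange k)]
  simp only [List.mem_finRange, if_true]

end IsPresentation

end Algorithm

end TransversalPresentation

open TransversalPresentation in
theorem mainTheorem1_general {E : Type*} {r : ℕ} (M : Matroid E) (A : Fin r → Set E)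
    (X : Matrix E (Fin r) ℕ) (hX : IsViableRepresentation M A X) :
    IsMaximalRepresentation M (algorithm X) ∧
    ∃ B : Fin r → Set E,
      IsRepresentation B (algorithm X) ∧
      (∀ j : Fin r, B j = A j ∪ (M.delete (A j)).coloops) ∧
      IsMaximalPresentation M B ∧
      (∀ C : Fin r → Set E, IsPresentation M C → PresentationLE C B) ∧
      (∀ C : Fin r → Set E, IsMaximalPresentation M C →
        ∃ σ : Equiv.Perm (Fin r), ∀ i, C i = B (σ i)) := by
  obtain ⟨hA, hAX, hr⟩ := hX
  have hrep : IsRepresentation (fun j ↦ coloopExtension M (A j)) (algorithm X) :=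
    hA.isRepresentation_algorithm hAX
  have hmax : IsMaximalPresentation M fun j ↦ coloopExtension M (A j) :=
    ⟨hA.isPresentation_coloopExtension, hr, fun C hC _ ↦ hA.presentationLE_coloopExtension hC⟩
  refine ⟨⟨_, hmax, hrep⟩, _, hrep, fun _ ↦ rfl, hmax,
    fun C hC ↦ hA.presentationLE_coloopExtension hC, fun C ⟨hC, _, hCmax⟩ ↦ ?_⟩
  have hle := hA.presentationLE_coloopExtension hC
  exact hle.exists_perm_eq (hCmax _ hmax.1 hle)

open TransversalPresentation in
theorem mainTheorem1 {E : Type*} [Finite E] {r : ℕ} (M : Matroid E) (A : Fin r → Set E)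
    (X : Matrix E (Fin r) ℕ) (hX : IsViableRepresentation M A X) :
    IsMaximalRepresentation M (algorithm X) ∧
    ∃ B : Fin r → Set E,
      IsRepresentation B (algorithm X) ∧
      (∀ j : Fin r, B j = A j ∪ (M.delete (A j)).coloops) ∧
      IsMaximalPresentation M B ∧
      (∀ C : Fin r → Set E, IsPresentation M C → PresentationLE C B) ∧
      (∀ C : Fin r → Set E, IsMaximalPresentation M C →
        ∃ σ : Equiv.Perm (Fin r), ∀ i, C i = B (σ i)) :=
  mainTheorem1_general M A X hX
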